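/- For a prime power $q$ and a positive integer $n$, let $V$ be an $n$-dimensional vector space over the field with $q$ elements, and let $M(n,q)$ be the minimum size of a set $\mathcal U$ of subspaces of $V$ (queries, all asked in advance) such that every one-dimensional subspace $\mathbf v\le V$ is determined by the answers to the questions "is $\mathbf v\le U$?" for $U\in\mathcal U$. Then: (a) There is an absolute constant $C>0$ such that for all prime powers $q$ we have $M(n,q)\le 2qn$ for every $n\ge 1$, and $\frac1C\,qn\le M(n,q)$ for every $n\ge 2$. (Trivially $M(1,q)=0$.) (b) As $q\to\infty$, $(1-o(1))\,q(n-1)\le M(n,q)$ uniformly in $n\ge 1$; that is, for every $\varepsilon>0$ there is $Q$ such that $(1-\varepsilon)\,q(n-1)\le M(n,q)$ for all prime powers $q\ge Q$ and all $n\ge 1$. In particular, $(1-o(1))\,qn\le M(n,q)$ as $q\to\infty$ and $n\to\infty$; that is, for every $\varepsilon>0$ there are $Q$ and $N$ such that $(1-\varepsilon)\,qn\le M(n,q)$ for all prime powers $q\ge Q$ and all $n\ge N$. -/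

import Mathlib

universe u v

namespace VectorSearch

/-- The one-dimensional subspaces of `V`: the possible positions of the marked subspace. -/
def points (F : Type u) (V : Type v) [Field F] [AddCommGroup V] [Module F V] :
    Set (Submodule F V) :=
  {x | Module.finrank F x = 1}

/-- The answers received when the marked subspace is `x` and all members `U` of the query set `𝒰`
are asked at once: the answer to `U` is YES (that is, `True`) if and only if `x ≤ U`. -/
def answers {F : Type u} {V : Type v} [Field F] [AddCommGroup V] [Module F V]
    (𝒰 : Finset (Submodule F V)) (x : Submodule F V) : 𝒰 → Prop :=
  fun U => x ≤ (U : Submodule F V)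

/-- A query set solves the non-adaptive search problem if the answers determine the marked
one-dimensional subspace, whichever it is. -/
def Determines {F : Type u} {V : Type v} [Field F] [AddCommGroup V] [Module F V]
    (𝒰 : Finset (Submodule F V)) : Prop :=
  Set.InjOn (answers 𝒰) (points F V)

/-- Such query sets are exactly the separating systems of subspaces: any two distinct
one-dimensional subspaces are told apart by some member. -/
theorem determines_iff_separating {F : Type u} {V : Type v} [Field F] [AddCommGroup V]
    [Module F V] (𝒰 : Finset (Submodule F V)) :
    Determines 𝒰 ↔ ∀ x ∈ points F V, ∀ y ∈ points F V, x ≠ y →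
      ∃ U ∈ 𝒰, (x ≤ U ∧ ¬ y ≤ U) ∨ (¬ x ≤ U ∧ y ≤ U) := by
  constructor
  · intro h x hx y hy hxy
    by_contra hcon
    push Not at hcon
    refine hxy (h hx hy (funext fun U => propext ?_))
    have := hcon U.1 U.2
    simp only [answers]
    tauto
  · intro h x hx y hy hxy
    by_contra hne
    obtain ⟨U, hU, hs⟩ := h x hx y hy hne
    have : (x ≤ U) = (y ≤ U) := congrFun hxy ⟨U, hU⟩
    rw [this] at hs
    tauto

/-- The minimum number of queries in a non-adaptive search for a one-dimensional subspace of `V`.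
If `V` has dimension `n` over the field `F` with `q` elements, this is the number `M(n, q)`. -/
noncomputable def nonadaptiveNumber (F : Type u) (V : Type v) [Field F] [AddCommGroup V]
    [Module F V] : ℕ :=
  sInf {k | ∃ 𝒰 : Finset (Submodule F V), Determines 𝒰 ∧ 𝒰.card = k}

/-- The minimum is attained when `V` is finite-dimensional over a finite field. -/
theorem exists_determines_card_eq (F : Type u) (V : Type v) [Field F] [Finite F]
    [AddCommGroup V] [Module F V] [FiniteDimensional F V] :
    ∃ 𝒰 : Finset (Submodule F V), Determines 𝒰 ∧ 𝒰.card = nonadaptiveNumber F V := by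
  classical
  have : Finite V := Module.finite_of_finite F
  have : Finite (Submodule F V) := Finite.of_injective _ SetLike.coe_injective
  have := Fintype.ofFinite (Submodule F V)
  refine Nat.sInf_mem
    (s := {k | ∃ 𝒰 : Finset (Submodule F V), Determines 𝒰 ∧ 𝒰.card = k})
    ⟨_, Finset.univ, ?_, rfl⟩
  intro x _ y _ h
  have h1 : (x ≤ x) = (y ≤ x) := congrFun h ⟨x, Finset.mem_univ x⟩
  have h2 : (x ≤ y) = (y ≤ y) := congrFun h ⟨y, Finset.mem_univ y⟩
  exact le_antisymm (h2 ▸ le_refl y) (h1 ▸ le_refl x)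

end VectorSearch

/-! Lower bound: mark the span of a uniformly random nonzero vector. The answers reveal at least `(n
- 1) log q` nats, while a query other than `V` is answered YES with probability at most `1 / q`, so
it carries at most the binary entropy of `1 / q`, which is about `log q / q`. Entropy of random
variables is never needed: `log_card_div_le_card_mul_binEntropy` compares the answers with
independent Bernoulli bits through `log t ≤ t - 1`.

Upper bound: a single random hyperplane rarely separates two given points, but a random pencil `ker
(u + t v)`, with `t` ranging over the field, fails with probability at most `1 / q`
(`card_pencil_not_separating_le`). There are fewer than `q ^ (2 n)` pairs of vectors to separate, so
by a union bound some `2 n` pencils, hence at most `2 n q` queries, suffice. -/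

namespace VectorSearch

open Finset Module

/-! ### Entropy bound for set systems -/

/-- The Bernoulli weights of the answer sets sum to at most the maximal fibre size. -/
theorem sum_bernoulli_weight_le {α β : Type*} [DecidableEq β] (s : Finset α) (T : Finset β)
    (Y : α → Finset β) (hY : ∀ x ∈ s, Y x ⊆ T) (k : ℕ)
    (hk : ∀ b, #{x ∈ s | Y x = b} ≤ k) {p : ℝ} (hp0 : 0 ≤ p) (hp1 : p ≤ 1) :
    ∑ x ∈ s, p ^ #(Y x) * (1 - p) ^ (#T - #(Y x)) ≤ k := by
  have hp : 0 ≤ 1 - p := by linarith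
  calc ∑ x ∈ s, p ^ #(Y x) * (1 - p) ^ (#T - #(Y x))
      = ∑ b ∈ T.powerset, ∑ x ∈ s with Y x = b, p ^ #(Y x) * (1 - p) ^ (#T - #(Y x)) :=
        (sum_fiberwise_of_maps_to (fun x hx => mem_powerset.2 (hY x hx)) _).symm
    _ ≤ ∑ b ∈ T.powerset, (k : ℝ) * (p ^ #b * (1 - p) ^ (#T - #b)) := by
        refine sum_le_sum fun b _ => ?_
        have : ∀ x ∈ ({x ∈ s | Y x = b} : Finset α),
            p ^ #(Y x) * (1 - p) ^ (#T - #(Y x)) = p ^ #b * (1 - p) ^ (#T - #b) := by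
          intro x hx
          rw [(mem_filter.1 hx).2]
        rw [sum_congr rfl this, sum_const, nsmul_eq_mul]
        have := hk b
        gcongr
    _ = k := by
        rw [← mul_sum, sum_pow_mul_eq_add_pow]
        simp

/-- The entropy bound: if `p ≤ 1 / 2`, no answer set is shared by more than `k` objects and every
query is answered YES by a fraction of at most `p` of the objects, then the number of queries is
at least `log (|s| / k)` divided by the binary entropy of `p`. -/
theorem log_card_div_le_card_mul_binEntropy {α β : Type*} [DecidableEq β] (s : Finset α)
    (T : Finset β) (r : α → β → Prop) [∀ x, DecidablePred (r x)] (k : ℕ)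
    (hk : ∀ b, #{x ∈ s | T.filter (r x) = b} ≤ k) {p : ℝ} (hp0 : 0 < p) (hp1 : p ≤ 1 / 2)
    (hT : ∀ U ∈ T, (#{x ∈ s | r x U} : ℝ) ≤ p * #s) (hs : s.Nonempty) :
    Real.log (#s / k) ≤ #T * Real.binEntropy p := by
  set Y : α → Finset β := fun x => T.filter (r x) with hYdef
  have hY : ∀ x, Y x ⊆ T := fun x => filter_subset _ _
  have hS : (0 : ℝ) < #s := by exact_mod_cast hs.card_pos
  have hk0 : (0 : ℝ) < k := by
    obtain ⟨x, hx⟩ := hs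
    have : 0 < #{z ∈ s | Y z = Y x} := card_pos.2 ⟨x, by simp [hx]⟩
    exact_mod_cast this.trans_le (hk _)
  have hq : 0 < 1 - p := by linarith
  have hw := sum_bernoulli_weight_le s T Y (fun x _ => hY x) k hk hp0.le (by linarith)
  -- This is `log t ≤ t - 1` with `t` equal to `|s| / k` times the Bernoulli weight. Summed over
  -- `s`, the right-hand side is at most `0`.
  have hlog : ∀ x ∈ s, Real.log (#s / k) + #(Y x) * Real.log p + (#T - #(Y x)) * Real.log (1 - p)
      ≤ #s / k * (p ^ #(Y x) * (1 - p) ^ (#T - #(Y x))) - 1 := by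
    intro x _
    have hpos : 0 < p ^ #(Y x) * (1 - p) ^ (#T - #(Y x)) := by positivity
    refine le_trans (le_of_eq ?_) (Real.log_le_sub_one_of_pos (mul_pos (div_pos hS hk0) hpos))
    rw [Real.log_mul (div_pos hS hk0).ne' hpos.ne', Real.log_mul (by positivity) (by positivity),
      Real.log_pow, Real.log_pow, Nat.cast_sub (card_le_card (hY x))]
    ring
  have hJ : ∑ x ∈ s, (#(Y x) : ℝ) ≤ p * #s * #T := by
    have : ∑ x ∈ s, #(Y x) = ∑ U ∈ T, #{x ∈ s | r x U} :=
      sum_card_bipartiteAbove_eq_sum_card_bipartiteBelow r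
    calc ∑ x ∈ s, (#(Y x) : ℝ) = ∑ U ∈ T, (#{x ∈ s | r x U} : ℝ) := by exact_mod_cast this
      _ ≤ ∑ U ∈ T, p * #s := sum_le_sum hT
      _ = p * #s * #T := by rw [sum_const, nsmul_eq_mul]; ring
  have hsum := sum_le_sum hlog
  simp only [sum_add_distrib, sum_sub_distrib, ← sum_mul, ← mul_sum, sum_const, nsmul_eq_mul,
    mul_one] at hsum
  have hle : (#s : ℝ) / k * ∑ x ∈ s, p ^ #(Y x) * (1 - p) ^ (#T - #(Y x)) ≤ #s := by
    calc _ ≤ (#s : ℝ) / k * k := by gcongr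
      _ = #s := by field_simp
  -- Only an upper bound on the number of YES answers is known; `p ≤ 1 / 2` gives their coefficient
  -- `log p - log (1 - p)` the sign that makes it enough.
  have hlp : Real.log p ≤ Real.log (1 - p) := Real.log_le_log hp0 (by linarith)
  rw [Real.binEntropy, Real.log_inv, Real.log_inv]
  refine le_of_mul_le_mul_left ?_ hS
  nlinarith [mul_nonneg (sub_nonneg.2 hJ) (sub_nonneg.2 hlp)]

theorem binEntropy_inv_le {q : ℝ} (hq : 1 < q) :
    Real.binEntropy q⁻¹ ≤ (Real.log q + 1) / q := by
  have hq0 : 0 < q := by linarith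
  have h1 : 0 < 1 - q⁻¹ := sub_pos.2 (inv_lt_one_of_one_lt₀ hq)
  have h2 : (1 - q⁻¹) * Real.log (1 - q⁻¹)⁻¹ ≤ q⁻¹ := by
    calc (1 - q⁻¹) * Real.log (1 - q⁻¹)⁻¹ ≤ (1 - q⁻¹) * ((1 - q⁻¹)⁻¹ - 1) := by
          gcongr
          exact Real.log_le_sub_one_of_pos (inv_pos.2 h1)
      _ = q⁻¹ := by rw [mul_sub, mul_inv_cancel₀ h1.ne']; ring
  rw [Real.binEntropy, inv_inv, add_div, one_div, div_eq_inv_mul]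
  linarith

/-! ### Points, functionals and pencils of hyperplanes -/

variable {F : Type u} {V : Type v} [Field F] [AddCommGroup V] [Module F V]

theorem exists_eq_span_singleton_of_mem_points {X : Submodule F V} (hX : X ∈ points F V) :
    ∃ x : V, x ≠ 0 ∧ X = F ∙ x := by
  obtain ⟨x, hx0, hx⟩ := finrank_eq_one_iff'.1 hX
  refine ⟨x, by simpa using hx0, le_antisymm (fun z hz => ?_) (by simp)⟩
  obtain ⟨c, hc⟩ := hx ⟨z, hz⟩
  exact Submodule.mem_span_singleton.2 ⟨c, congrArg Subtype.val hc⟩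

/-- The query `V` is always answered YES, so it separates nothing; it has to go because it violates
the `1 / q` bound on YES answers. -/
theorem determines_erase_top [DecidableEq (Submodule F V)] {T : Finset (Submodule F V)}
    (hT : Determines T) : Determines (T.erase ⊤) := by
  rw [determines_iff_separating] at hT ⊢
  intro x hx y hy hxy
  obtain ⟨U, hU, h⟩ := hT x hx y hy hxy
  refine ⟨U, mem_erase.2 ⟨?_, hU⟩, h⟩
  rintro rfl
  simp at h

/-- The pencil of hyperplanes `ker (u + t v)` fails to separate `x` from `y` only if `u` and `v`
both vanish at some `y - c x`. -/
theorem exists_forall_apply_eq_mul {x y : V} {u v : Dual F V}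
    (h : ∀ t : F, (u + t • v) x = 0 ↔ (u + t • v) y = 0) :
    ∃ c : F, u (y - c • x) = 0 ∧ v (y - c • x) = 0 := by
  simp only [LinearMap.add_apply, LinearMap.smul_apply, smul_eq_mul, map_sub, map_smul] at h ⊢
  by_cases hvx : v x = 0
  · have hvy : v y = 0 := by
      by_contra hvy
      -- This `t` makes `u + t v` vanish at `y`, which forces `u x = 0`. Then every member of the
      -- pencil vanishes at `x`, hence at `y`, and comparing `t` with `t + 1` gives `v y = 0`.
      have h1 := (h (-(u y / v y))).2 (by field_simp; ring)
      rw [hvx, mul_zero, add_zero] at h1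
      have h2 := h (-(u y / v y) + 1)
      rw [hvx, h1] at h2
      have h3 := h2.1 (by simp)
      apply hvy
      have h4 : u y / v y * v y = u y := div_mul_cancel₀ _ hvy
      linear_combination h3 + h4
    by_cases hux : u x = 0
    · refine ⟨0, ?_, by simp [hvy]⟩
      have := (h 0).1 (by simp [hux])
      simpa using this
    · exact ⟨u y / u x, by rw [div_mul_cancel₀ _ hux, sub_self], by simp [hvx, hvy]⟩
  · refine ⟨v y / v x, ?_, by rw [div_mul_cancel₀ _ hvx, sub_self]⟩
    have h1 := (h (-(u x / v x))).1 (by field_simp; ring)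
    have : u y - v y / v x * u x = u y + -(u x / v x) * v y := by ring
    rw [this, h1]

/-- The functionals vanishing at a nonzero vector form a `1 / q` fraction of the dual. -/
theorem card_mul_card_ker_eval [FiniteDimensional F V] {z : V} (hz : z ≠ 0) :
    Nat.card F * Nat.card {u : Dual F V // u z = 0} = Nat.card (Dual F V) := by
  have hrange : LinearMap.range (Dual.eval F V z) = ⊤ :=
    LinearMap.range_eq_top.2 (LinearMap.surjective fun h => hz ((forall_dual_apply_eq_zero_iff F z).1 fun u => LinearMap.congr_fun h u))
  have h1 := LinearMap.finrank_range_add_finrank_ker (Dual.eval F V z)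
  rw [hrange, finrank_top, finrank_self] at h1
  have h2 : Nat.card {u : Dual F V // u z = 0} =
      Nat.card (LinearMap.ker (Dual.eval F V z)) := rfl
  rw [h2, Module.natCard_eq_pow_finrank (K := F) (V := LinearMap.ker _),
    Module.natCard_eq_pow_finrank (K := F) (V := Dual F V), ← h1, pow_add, pow_one]

variable [Finite F]

/-- At most `q - 1` nonzero vectors span a given point. -/
theorem card_filter_span_eq_le [Fintype V] (P : Submodule F V)
    [DecidablePred fun x : V => x ≠ 0 ∧ F ∙ x = P] :
    #{x : V | x ≠ 0 ∧ F ∙ x = P} ≤ Nat.card F - 1 := by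
  classical
  have := Fintype.ofFinite F
  rcases (({x : V | x ≠ 0 ∧ F ∙ x = P} : Finset V)).eq_empty_or_nonempty with h | ⟨y, hy⟩
  · simp [h]
  · obtain ⟨hy0, hyP⟩ := (mem_filter.1 hy).2
    have hsub : ({x : V | x ≠ 0 ∧ F ∙ x = P} : Finset V) ⊆
        (univ.erase (0 : F)).image fun c => c • y := by
      intro x hx
      obtain ⟨hx0, hxP⟩ := (mem_filter.1 hx).2
      obtain ⟨c, rfl⟩ := Submodule.mem_span_singleton.1
        (hyP ▸ hxP ▸ Submodule.mem_span_singleton_self x : x ∈ F ∙ y)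
      exact mem_image.2 ⟨c, mem_erase.2 ⟨fun h => hx0 (by simp [h]), mem_univ _⟩, rfl⟩
    refine (card_le_card hsub).trans (card_image_le.trans (le_of_eq ?_))
    rw [card_erase_of_mem (mem_univ _), card_univ, Nat.card_eq_fintype_card]

/-! ### Lower bound -/

variable [FiniteDimensional F V]

theorem card_mul_card_le_of_ne_top {U : Submodule F V} (hU : U ≠ ⊤) :
    Nat.card F * Nat.card U ≤ Nat.card V := by
  rw [Module.natCard_eq_pow_finrank (K := F) (V := U),
    Module.natCard_eq_pow_finrank (K := F) (V := V), ← pow_succ']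
  exact Nat.pow_le_pow_right Nat.card_pos (Submodule.finrank_lt hU)

/-- The entropy bound for separating systems of subspaces. -/
theorem mul_log_le_card_mul_binEntropy (hn : 1 ≤ finrank F V) {T : Finset (Submodule F V)}
    (hT : Determines T) (htop : ⊤ ∉ T) :
    ((finrank F V : ℝ) - 1) * Real.log (Nat.card F) ≤
      #T * Real.binEntropy (Nat.card F : ℝ)⁻¹ := by
  classical
  have : Finite V := Module.finite_of_finite F
  have := Fintype.ofFinite V
  have hq : 1 < Nat.card F := Finite.one_lt_card
  have hqr : (2 : ℝ) ≤ Nat.card F := by exact_mod_cast hq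
  have hnt : Nontrivial V := Module.finrank_pos_iff.1 hn
  -- Nonzero vectors stand in for points; each point is counted at most `q - 1` times, hence the
  -- fibre bound `k = q - 1`.
  set s : Finset V := univ.erase 0 with hs
  have hcs : #s = Nat.card F ^ finrank F V - 1 := by
    rw [hs, card_erase_of_mem (mem_univ _), card_univ, ← Nat.card_eq_fintype_card,
      Module.natCard_eq_pow_finrank (K := F)]
  have hcV : 0 < Nat.card F ^ finrank F V := by positivity
  have hne : s.Nonempty := by
    obtain ⟨x, hx⟩ := exists_ne (0 : V)
    exact ⟨x, by simp [hs, hx]⟩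
  have hfib : ∀ b, #{x ∈ s | {U ∈ T | F ∙ x ≤ U} = b} ≤ Nat.card F - 1 := by
    intro b
    rcases (({x ∈ s | {U ∈ T | F ∙ x ≤ U} = b} : Finset V)).eq_empty_or_nonempty with h | ⟨y, hy⟩
    · rw [h, card_empty]; exact Nat.zero_le _
    · refine le_trans (card_le_card fun x hx => ?_) (card_filter_span_eq_le (F ∙ y))
      obtain ⟨hxs, hxb⟩ := mem_filter.1 hx
      obtain ⟨hys, hyb⟩ := mem_filter.1 hy
      have hx0 : x ≠ 0 := (mem_erase.1 hxs).1
      have hy0 : y ≠ 0 := (mem_erase.1 hys).1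
      refine mem_filter.2 ⟨mem_univ _, hx0, ?_⟩
      refine hT (finrank_span_singleton hx0) (finrank_span_singleton hy0) ?_
      funext U
      have := congrArg (fun t => U.1 ∈ t) (hxb.trans hyb.symm)
      simpa [answers, U.2] using this
  have hyes : ∀ U ∈ T, (#{x ∈ s | F ∙ x ≤ U} : ℝ) ≤ (Nat.card F : ℝ)⁻¹ * #s := by
    intro U hU
    have hUtop : U ≠ ⊤ := fun h => htop (h ▸ hU)
    have h1 := card_mul_card_le_of_ne_top hUtop
    -- The `+ 1` counts the zero vector of `U`; without it the fraction would be compared with `q ^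
    -- n` instead of `|s| = q ^ n - 1`.
    have h2 : #{x ∈ s | F ∙ x ≤ U} + 1 ≤ Nat.card U := by
      have h0 : (0 : V) ∉ ({x ∈ s | F ∙ x ≤ U} : Finset V) := by simp [hs]
      rw [← card_insert_of_notMem h0, Nat.card_eq_fintype_card, Fintype.card_subtype]
      refine card_le_card fun x hx => ?_
      rcases mem_insert.1 hx with rfl | hx
      · simp
      · simpa using (mem_filter.1 hx).2
    rw [Module.natCard_eq_pow_finrank (K := F) (V := V)] at h1
    have h3 : Nat.card F * #{x ∈ s | F ∙ x ≤ U} ≤ #s := by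
      have := Nat.mul_le_mul_left (Nat.card F) h2
      rw [mul_add, mul_one] at this
      omega
    rw [le_inv_mul_iff₀ (by positivity)]
    exact_mod_cast h3
  refine le_trans ?_ (log_card_div_le_card_mul_binEntropy s T (fun x U => F ∙ x ≤ U)
    (Nat.card F - 1) hfib (by positivity) (by
      rw [one_div]; exact inv_anti₀ (by norm_num) hqr) hyes hne)
  obtain ⟨m, hm⟩ := Nat.exists_eq_add_of_le' hn
  have hgeom : (Nat.card F : ℝ) ^ m ≤ #s / (Nat.card F - 1 : ℕ) := by
    rw [hcs, hm, Nat.cast_sub hq.le, Nat.cast_sub (Nat.one_le_pow _ _ (by omega)),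
      le_div_iff₀ (by push_cast; linarith)]
    push_cast
    have : (1 : ℝ) ≤ (Nat.card F : ℝ) ^ m := one_le_pow₀ (by linarith)
    rw [pow_succ]
    nlinarith
  have hl := Real.log_le_log (by positivity) hgeom
  rw [Real.log_pow] at hl
  rw [hm]
  push_cast
  simpa using hl

/-- The explicit lower bound `q (n - 1) log q / (log q + 1) ≤ M(n, q)`. -/
theorem mul_log_div_le_nonadaptiveNumber (F : Type u) (V : Type v) [Field F] [Finite F]
    [AddCommGroup V] [Module F V] [FiniteDimensional F V] (hn : 1 ≤ finrank F V) :
    (Nat.card F : ℝ) * ((finrank F V : ℝ) - 1) *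
      (Real.log (Nat.card F) / (Real.log (Nat.card F) + 1)) ≤ nonadaptiveNumber F V := by
  classical
  obtain ⟨T, hT, hcard⟩ := exists_determines_card_eq F V
  have hq : (1 : ℝ) < Nat.card F := by exact_mod_cast Finite.one_lt_card (α := F)
  have hl : 0 < Real.log (Nat.card F) := Real.log_pos hq
  have h := mul_log_le_card_mul_binEntropy hn (determines_erase_top hT) (notMem_erase _ _)
  have hle : (#(T.erase ⊤) : ℝ) ≤ nonadaptiveNumber F V := by
    rw [← hcard]; exact_mod_cast card_erase_le
  have h2 : ((finrank F V : ℝ) - 1) * Real.log (Nat.card F) ≤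
      nonadaptiveNumber F V * ((Real.log (Nat.card F) + 1) / Nat.card F) := by
    exact h.trans (mul_le_mul hle (binEntropy_inv_le hq)
      (Real.binEntropy_nonneg (by positivity) (inv_le_one_of_one_le₀ hq.le)) (Nat.cast_nonneg _))
  rw [← mul_div_assoc, le_div_iff₀ (by linarith)] at h2
  rw [← mul_div_assoc, div_le_iff₀ (by linarith)]
  linarith

/-! ### Upper bound by random pencils -/

/-- A failing pair `(u, v)` has both entries vanishing at `y - c x` for some `c`. For each `c` this
has probability `q⁻²`, and there are `q` choices of `c`. -/
theorem card_pencil_not_separating_le [Fintype (Dual F V)] {x y : V}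
    (hxy : ∀ c : F, y - c • x ≠ 0)
    [DecidablePred fun w : Dual F V × Dual F V =>
      ∀ t : F, (w.1 + t • w.2) x = 0 ↔ (w.1 + t • w.2) y = 0] :
    Nat.card F * #{w : Dual F V × Dual F V | ∀ t : F, (w.1 + t • w.2) x = 0 ↔
      (w.1 + t • w.2) y = 0} ≤ Fintype.card (Dual F V × Dual F V) := by
  classical
  have := Fintype.ofFinite F
  set K : F → Finset (Dual F V) := fun c => {u | u (y - c • x) = 0} with hK
  have hKc : ∀ c, Nat.card F * #(K c) = Fintype.card (Dual F V) := by
    intro c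
    have := card_mul_card_ker_eval (F := F) (hxy c)
    rwa [Nat.card_eq_fintype_card (α := Dual F V), Nat.card_eq_fintype_card (α := Subtype _),
      Fintype.card_subtype] at this
  have hsub : ({w : Dual F V × Dual F V | ∀ t : F, (w.1 + t • w.2) x = 0 ↔
      (w.1 + t • w.2) y = 0} : Finset _) ⊆ univ.biUnion fun c => K c ×ˢ K c := by
    intro w hw
    obtain ⟨c, h1, h2⟩ := exists_forall_apply_eq_mul (mem_filter.1 hw).2
    exact mem_biUnion.2 ⟨c, mem_univ _, mem_product.2
      ⟨mem_filter.2 ⟨mem_univ _, h1⟩, mem_filter.2 ⟨mem_univ _, h2⟩⟩⟩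
  calc _ ≤ Nat.card F * ∑ c : F, #(K c ×ˢ K c) :=
        Nat.mul_le_mul_left _ ((card_le_card hsub).trans card_biUnion_le)
    _ = ∑ c : F, #(K c) * Fintype.card (Dual F V) := by
        rw [mul_sum]
        refine sum_congr rfl fun c _ => ?_
        rw [card_product, ← mul_assoc, hKc, mul_comm]
    _ = Fintype.card (Dual F V × Dual F V) := by
        have h0 : ∑ c : F, #(K c) = Fintype.card (Dual F V) := by
          have hpos : 0 < Nat.card F := Nat.card_pos
          refine Nat.eq_of_mul_eq_mul_left hpos ?_
          rw [mul_sum, sum_congr rfl fun c _ => hKc c, sum_const, card_univ,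
            ← Nat.card_eq_fintype_card (α := F), smul_eq_mul]
        rw [← sum_mul, h0, Fintype.card_prod]

/-- Some `2 n` pencils of hyperplanes separate all pairs of non-proportional vectors. -/
theorem exists_separating_pencils (F : Type u) (V : Type v) [Field F] [Finite F]
    [AddCommGroup V] [Module F V] [FiniteDimensional F V] :
    ∃ w : Fin (2 * finrank F V) → Dual F V × Dual F V,
      ∀ x y : V, x ≠ 0 → (∀ c : F, y - c • x ≠ 0) →
        ∃ i, ∃ t : F, ¬ (((w i).1 + t • (w i).2) x = 0 ↔ ((w i).1 + t • (w i).2) y = 0) := by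
  classical
  have : Finite V := Module.finite_of_finite F
  have : Finite (Dual F V) := Module.finite_of_finite F
  have := Fintype.ofFinite V
  have := Fintype.ofFinite (Dual F V)
  set n := finrank F V with hn
  set D := Dual F V × Dual F V
  set B : V × V → Finset D := fun p =>
    {w | ∀ t : F, (w.1 + t • w.2) p.1 = 0 ↔ (w.1 + t • w.2) p.2 = 0} with hB
  set P : Finset (V × V) := {p | p.1 ≠ 0 ∧ ∀ c : F, p.2 - c • p.1 ≠ 0} with hP
  -- Strictness, from the excluded pair `(0, 0)`, is what makes the union bound leave a good choice.
  have hPc : #P < Nat.card F ^ (2 * n) := by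
    have : #P < Fintype.card (V × V) := by
      rw [← card_univ]
      exact card_lt_card ⟨subset_univ _, fun h => by simpa [hP] using h (mem_univ (0, 0))⟩
    rwa [Fintype.card_prod, ← Nat.card_eq_fintype_card,
      Module.natCard_eq_pow_finrank (K := F) (V := V), ← pow_add, ← two_mul] at this
  -- All `2 n` independent pencils fail on a given pair with probability at most `q ^ (-2 n)`.
  have hBc : ∀ p ∈ P, Nat.card F ^ (2 * n) * #(Fintype.piFinset fun _ : Fin (2 * n) => B p) ≤
      Fintype.card D ^ (2 * n) := by
    intro p hp
    rw [Fintype.card_piFinset_const, ← mul_pow]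
    exact Nat.pow_le_pow_left (card_pencil_not_separating_le (mem_filter.1 hp).2.2) _
  have hlt : #(P.biUnion fun p => Fintype.piFinset fun _ : Fin (2 * n) => B p) <
      #(univ : Finset (Fin (2 * n) → D)) := by
    have hDpos : 0 < Fintype.card D ^ (2 * n) := by
      have : 0 < Fintype.card D := Fintype.card_pos_iff.2 ⟨0⟩
      positivity
    rw [card_univ, Fintype.card_fun, Fintype.card_fin]
    refine lt_of_mul_lt_mul_left (a := Nat.card F ^ (2 * n)) ?_ (Nat.zero_le _)
    calc _ ≤ Nat.card F ^ (2 * n) *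
          ∑ p ∈ P, #(Fintype.piFinset fun _ : Fin (2 * n) => B p) :=
          Nat.mul_le_mul_left _ card_biUnion_le
      _ ≤ ∑ p ∈ P, Fintype.card D ^ (2 * n) := by
          rw [mul_sum]; exact sum_le_sum hBc
      _ = #P * Fintype.card D ^ (2 * n) := by rw [sum_const, smul_eq_mul]
      _ < _ := Nat.mul_lt_mul_of_pos_right hPc hDpos
  obtain ⟨w, -, hw⟩ := exists_mem_notMem_of_card_lt_card hlt
  refine ⟨w, fun x y hx hxy => ?_⟩
  by_contra hcon
  push Not at hcon
  exact hw (mem_biUnion.2 ⟨(x, y), mem_filter.2 ⟨mem_univ _, hx, hxy⟩,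
    Fintype.mem_piFinset.2 fun i => mem_filter.2 ⟨mem_univ _, hcon i⟩⟩)

theorem nonadaptiveNumber_le (F : Type u) (V : Type v) [Field F] [Finite F]
    [AddCommGroup V] [Module F V] [FiniteDimensional F V] :
    nonadaptiveNumber F V ≤ 2 * Nat.card F * finrank F V := by
  classical
  have := Fintype.ofFinite F
  obtain ⟨w, hw⟩ := exists_separating_pencils F V
  set T : Finset (Submodule F V) := univ.image fun i : Fin (2 * finrank F V) × F =>
    LinearMap.ker ((w i.1).1 + i.2 • (w i.1).2) with hT
  have hdet : Determines T := by
    rw [determines_iff_separating]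
    intro X hX Y hY hXY
    obtain ⟨x, hx0, rfl⟩ := exists_eq_span_singleton_of_mem_points hX
    obtain ⟨y, hy0, rfl⟩ := exists_eq_span_singleton_of_mem_points hY
    obtain ⟨i, t, hit⟩ := hw x y hx0 (by
      intro c hc
      apply hXY
      have hyx : y = c • x := sub_eq_zero.1 hc
      have hc0 : c ≠ 0 := by rintro rfl; exact hy0 (by simpa using hyx)
      rw [hyx, Submodule.span_singleton_smul_eq (IsUnit.mk0 c hc0)])
    refine ⟨_, mem_image_of_mem _ (mem_univ (i, t)), ?_⟩
    simp only [Submodule.span_singleton_le_iff_mem, LinearMap.mem_ker]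
    tauto
  calc nonadaptiveNumber F V ≤ #T := Nat.sInf_le ⟨T, hdet, rfl⟩
    _ ≤ #(univ : Finset (Fin (2 * finrank F V) × F)) := card_image_le
    _ = 2 * Nat.card F * finrank F V := by
        rw [card_univ, Fintype.card_prod, Fintype.card_fin, Nat.card_eq_fintype_card]; ring

/-! ### Asymptotics and constants -/

/-- For large `q`, uniformly in the dimension, `(1 - ε) q (n - 1) ≤ M(n, q)`. -/
theorem exists_forall_one_sub_mul_le {ε : ℝ} (hε : 0 < ε) : ∃ Q : ℕ,
    ∀ (F : Type u) (V : Type v) [Field F] [Finite F] [AddCommGroup V] [Module F V]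
      [FiniteDimensional F V], Q ≤ Nat.card F → 1 ≤ finrank F V →
        (1 - ε) * ((Nat.card F : ℝ) * ((finrank F V : ℝ) - 1)) ≤ nonadaptiveNumber F V := by
  -- Chosen so that `ε log q ≥ 1`, whence `log q / (log q + 1) ≥ 1 - ε`.
  refine ⟨⌈Real.exp ε⁻¹⌉₊, ?_⟩
  intro F V _ _ _ _ _ hQ hn
  refine le_trans ?_ (mul_log_div_le_nonadaptiveNumber F V hn)
  have hlog : ε⁻¹ ≤ Real.log (Nat.card F) :=
    (Real.le_log_iff_exp_le (by exact_mod_cast Nat.card_pos)).2 (Nat.ceil_le.1 hQ)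
  have hpos : 0 < Real.log (Nat.card F) := (inv_pos.2 hε).trans_le hlog
  have hn' : (0 : ℝ) ≤ (finrank F V : ℝ) - 1 := by
    rw [sub_nonneg]; exact_mod_cast hn
  rw [mul_comm]
  gcongr
  rw [le_div_iff₀ (by linarith)]
  have : 1 ≤ ε * Real.log (Nat.card F) := (inv_le_iff_one_le_mul₀' hε).1 hlog
  nlinarith

end VectorSearch

/-- Throughout, `q = Nat.card F` (automatically a prime power), `n = Module.finrank F V`, and
`VectorSearch.nonadaptiveNumber F V` is `M(n, q)`. -/
theorem theorem1p4 :
    -- absolute constant; the lower bound needs `n ≥ 2`, since `M(1, q) = 0`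
    (∃ C : ℝ, 0 < C ∧
      ∀ (F : Type u) (V : Type v) [Field F] [Finite F] [AddCommGroup V] [Module F V]
        [FiniteDimensional F V],
        (2 ≤ Module.finrank F V →
          1 / C * ((Nat.card F : ℝ) * (Module.finrank F V : ℝ)) ≤
            (VectorSearch.nonadaptiveNumber F V : ℝ)) ∧
        (1 ≤ Module.finrank F V →
          VectorSearch.nonadaptiveNumber F V ≤ 2 * Nat.card F * Module.finrank F V)) ∧
    -- `(1 - o(1)) q (n - 1) ≤ M(n, q)` as `q → ∞`, uniformly in `n`
    (∀ ε : ℝ, 0 < ε → ∃ Q : ℕ,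
      ∀ (F : Type u) (V : Type v) [Field F] [Finite F] [AddCommGroup V] [Module F V]
        [FiniteDimensional F V],
        Q ≤ Nat.card F → 1 ≤ Module.finrank F V →
          (1 - ε) * ((Nat.card F : ℝ) * ((Module.finrank F V : ℝ) - 1)) ≤
            (VectorSearch.nonadaptiveNumber F V : ℝ)) ∧
    -- hence `(1 - o(1)) q n ≤ M(n, q)` as `q → ∞` and `n → ∞`
    (∀ ε : ℝ, 0 < ε → ∃ Q N : ℕ,
      ∀ (F : Type u) (V : Type v) [Field F] [Finite F] [AddCommGroup V] [Module F V]
        [FiniteDimensional F V],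
        Q ≤ Nat.card F → N ≤ Module.finrank F V →
          (1 - ε) * ((Nat.card F : ℝ) * (Module.finrank F V : ℝ)) ≤
            (VectorSearch.nonadaptiveNumber F V : ℝ)) := by
  -- The constant `5` comes from `n - 1 ≥ n / 2` and `log q / (log q + 1) ≥ 2 / 5`, the latter
  -- because `log 2 > 2 / 3`.
  refine ⟨⟨5, by norm_num, fun F V _ _ _ _ _ => ⟨fun hn => ?_, fun _ => ?_⟩⟩,
    fun ε hε => VectorSearch.exists_forall_one_sub_mul_le hε, fun ε hε => ?_⟩
  · refine le_trans ?_ (VectorSearch.mul_log_div_le_nonadaptiveNumber F V (by omega))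
    have hq : (2 : ℝ) ≤ Nat.card F := by exact_mod_cast Finite.one_lt_card (α := F)
    have hn' : (2 : ℝ) ≤ Module.finrank F V := by exact_mod_cast hn
    have hl : 2 / 3 ≤ Real.log (Nat.card F) := by
      have := Real.log_two_gt_d9
      have := Real.log_le_log (by norm_num) hq
      linarith
    have hr : 2 / 5 ≤ Real.log (Nat.card F) / (Real.log (Nat.card F) + 1) := by
      rw [le_div_iff₀ (by linarith)]
      linarith
    calc 1 / 5 * ((Nat.card F : ℝ) * (Module.finrank F V : ℝ))
        ≤ (Nat.card F : ℝ) * ((Module.finrank F V : ℝ) - 1) * (2 / 5) := by nlinarith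
      _ ≤ _ := by
        have : (0 : ℝ) ≤ (Module.finrank F V : ℝ) - 1 := by linarith
        gcongr
  · exact VectorSearch.nonadaptiveNumber_le F V
  · obtain ⟨Q, hQ⟩ := VectorSearch.exists_forall_one_sub_mul_le.{u, v} (half_pos hε)
    -- Half of `ε` is spent on `q`, the other half on replacing `n - 1` by `n`, which needs `n ε ≥
    -- 2`. The `+ 1` ensures `n ≥ 1`.
    refine ⟨Q, ⌈2 / ε⌉₊ + 1, fun F V _ _ _ _ _ hq hn => ?_⟩
    have hb := hQ F V hq (by omega)
    rcases le_total 1 ε with h1 | h1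
    · have : (0 : ℝ) ≤ (Nat.card F : ℝ) * (Module.finrank F V : ℝ) := by positivity
      have h0 : (0 : ℝ) ≤ VectorSearch.nonadaptiveNumber F V := Nat.cast_nonneg _
      nlinarith
    · have hn' : 2 / ε ≤ (Module.finrank F V : ℝ) :=
        (Nat.le_ceil _).trans (by exact_mod_cast (Nat.le_succ _).trans hn)
      rw [div_le_iff₀ hε] at hn'
      refine le_trans ?_ hb
      have key : (1 - ε) * (Module.finrank F V : ℝ) ≤
          (1 - ε / 2) * ((Module.finrank F V : ℝ) - 1) := by nlinarith
      have hc : (0 : ℝ) ≤ Nat.card F := Nat.cast_nonneg _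
      nlinarith [mul_le_mul_of_nonneg_left key hc]
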